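/- A server holds $N$ files of $F$ bits each and is connected by an error-free broadcast link to $K\le N$ users. Each user has free access to exactly one of $\Lambda$ caches, cache $\lambda$ serving $L_\lambda$ users, so that $\sum_{\lambda=1}^{\Lambda}L_\lambda=K$; put $\boldsymbol L=(L_1,\dots,L_\Lambda)$. An uncoded cache placement $\mathcal Z=(\mathcal Z_1,\dots,\mathcal Z_\Lambda)$ stores in each cache $\lambda$ a set $\mathcal Z_\lambda$ of library bits; it may depend on $\boldsymbol L$, but not on the demands. It uses the normalized cache sizes $\gamma_\lambda=|\mathcal Z_\lambda|/(NF)$ and the normalized sum cache size $\sum_{\lambda}\gamma_\lambda$. It is regular if every bit of the library is stored in the same number of caches. For a demand vector $\boldsymbol d\in\{1,\dots,N\}^K$, let $T^*(\mathcal Z,\boldsymbol d,\boldsymbol L)$ be the minimum of $\frac{1}{F}\log_2 M$ over all delivery schemes in which the server, knowing the library, $\mathcal Z$ and $\boldsymbol d$, broadcasts a message with at most $M$ values from which, together with the content of its own cache, every user $k$ recovers file $d_k$ without error, for every library content. Let $$T^*(t,\boldsymbol L)=\inf_{F,\,\mathcal Z}\ \max_{\boldsymbol d}\ T^*(\mathcal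 Z,\boldsymbol d,\boldsymbol L),$$ where $F$ runs over the positive integers and $\mathcal Z$ over the regular uncoded placements with $\sum_\lambda\gamma_\lambda=t$ (so that the memory allocation $\gamma_1,\dots,\gamma_\Lambda$ is optimized as well). For $k\ge 0$ let $e_k(\boldsymbol L)=\sum_{q\subseteq\{1,\dots,\Lambda\},\,|q|=k}\ \prod_{\lambda\in q}L_\lambda$ be the $k$-th elementary symmetric polynomial of the cache occupancies, with $e_0=1$ and $e_k=0$ for $k>\Lambda$. **Theorem.** Let $t\in\{0,1,\dots,\Lambda\}$ be such that $e_t(\boldsymbol L)\neq 0$ (which holds automatically if no cache is empty, i.e. $L_\lambda\ge 1$ for all $\lambda$). Then $$T^*(t,\boldsymbol L)\ \ge\ \frac{e_{t+1}(\boldsymbol L)}{e_t(\boldsymbol L)}=\frac{\sum_{q\subseteq\{1,\dots,\Lambda\},\,|q|=t+1}\prod_{\lambda\in q}L_\lambda}{\sum_{q\subseteq\{1,\dots,\Lambda\},\,|q|=t}\prod_{\lambda\in q}L_\lambda}.$$ In the case of dedicated caches, $L_\lambda=1$ for all $\lambda$ and $K=\Lambda$, this lower bound reduces to the optimal delivery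 time of Yu, Maddah-Ali and Avestimehr for uncoded placement at integer $t$, that is, the bound equals $$\frac{\binom{K}{t+1}-\binom{K-\min\{K,N\}}{t+1}}{\binom{K}{t}}=\frac{K-t}{t+1}.$$ -/

import Mathlib

namespace SharedCache

/-- The library: `N` files of `F` bits each. -/
abbrev Library (N F : ℕ) : Type := Fin N → Fin F → Bool

/-- The users: cache `c` serves the `L c` users `⟨c, 0⟩, …, ⟨c, L c - 1⟩`. The number of users is
`K = ∑ c, L c`. -/
abbrev User {Λ : ℕ} (L : Fin Λ → ℕ) : Type := Σ c : Fin Λ, Fin (L c)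

/-- An uncoded cache placement for `Λ` caches: cache `c` stores a set of library bits, where the
pair `(n, i)` names the `i`-th bit of file `n`. -/
abbrev Placement (Λ N F : ℕ) : Type := Fin Λ → Finset (Fin N × Fin F)

/-- The normalized size of cache `c`: the fraction of the library that it stores. -/
noncomputable def normSize {Λ N F : ℕ} (Z : Placement Λ N F) (c : Fin Λ) : ℝ :=
  ((Z c).card : ℝ) / ((N : ℝ) * (F : ℝ))

/-- The normalized sum cache size. -/
noncomputable def redundancy {Λ N F : ℕ} (Z : Placement Λ N F) : ℝ :=
  ∑ c, normSize Z c

/-- Regular placement: every library bit is stored in the same number of caches. -/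
def IsRegular {Λ N F : ℕ} (Z : Placement Λ N F) : Prop :=
  ∃ r : ℕ, ∀ b : Fin N × Fin F, (Finset.univ.filter (fun c => b ∈ Z c)).card = r

/-- The content of cache `c` when the library is `W`. -/
def cacheContent {Λ N F : ℕ} (Z : Placement Λ N F) (c : Fin Λ) (W : Library N F) :
    {b : Fin N × Fin F // b ∈ Z c} → Bool :=
  fun b => W b.1.1 b.1.2

/-- A delivery scheme for the placement `Z` and the demand `d`, whose broadcast message takes at
most `M` values: every user recovers the requested file, without error and for every library, from
the message and the content of its own cache. -/
structure DeliveryScheme {Λ N F : ℕ} (L : Fin Λ → ℕ) (Z : Placement Λ N F)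
    (d : User L → Fin N) (M : ℕ) where
  /-- the transmitter's encoder -/
  enc : Library N F → Fin M
  /-- the decoder of each user -/
  dec : (u : User L) → Fin M → ({b : Fin N × Fin F // b ∈ Z u.1} → Bool) → (Fin F → Bool)
  /-- every user decodes its requested file -/
  correct : ∀ (W : Library N F) (u : User L), dec u (enc W) (cacheContent Z u.1 W) = W (d u)

/-- Delivery time for the placement `Z` and the demand `d`: the least number of transmitted bits
`log₂ M`, in units of files. -/
noncomputable def deliveryTime {Λ N F : ℕ} (L : Fin Λ → ℕ) (Z : Placement Λ N F)
    (d : User L → Fin N) : EReal :=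
  ⨅ (M : ℕ) (_ : Nonempty (DeliveryScheme L Z d M)),
    ((Real.logb 2 (M : ℝ) / (F : ℝ) : ℝ) : EReal)

/-- Worst-case delivery time of the placement `Z` over all demands. -/
noncomputable def worstDeliveryTime {Λ N F : ℕ} (L : Fin Λ → ℕ) (Z : Placement Λ N F) : EReal :=
  ⨆ d : User L → Fin N, deliveryTime L Z d

/-- The optimal delivery time under regular and uncoded placement: the infimum of the worst-case
delivery time over all file lengths `F` and over all regular uncoded placements (hence over all
memory allocations) whose normalized sum cache size is `t`. -/
noncomputable def optimalRegularDeliveryTime {Λ : ℕ} (N : ℕ) (L : Fin Λ → ℕ) (t : ℝ) : EReal :=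
  ⨅ (F : ℕ) (_ : 0 < F) (Z : Placement Λ N F) (_ : IsRegular Z) (_ : redundancy Z = t),
    worstDeliveryTime L Z

/-- The `k`-th elementary symmetric function of the entries of `L`, taken with multiplicity. -/
def elemSymm {Λ : ℕ} (L : Fin Λ → ℕ) (k : ℕ) : ℕ :=
  (Finset.univ.val.map L).esymm k

end SharedCache

/-! Fix an order of the caches and visit them in turn, decoding at each one. The message and the
bits that are not fresh then determine the library, so `2 ^ #fresh ≤ M`
(`two_pow_card_freshBits_le`). Over the `N` cyclic shifts of one injective demand, the fresh counts
sum to `orderValue`, which does not involve the demand (`sum_freshCount_shift`). Hence one order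
serves all shifts, and some shift attains the mean. A good order exists when every bit lies in
exactly `t` caches (`exists_order`): averaging yields a first cache `c` missing at least the
fraction `e_t(A \ c) / e_t(A)` of the bits, and `e_{t+1}(A) = L c * e_t(A \ c) + e_{t+1}(A \ c)`
carries the induction. The value is at least `N * F * e_{t+1} / e_t`. -/

namespace SharedCache

open Finset

/-! ### Symmetric functions and the choice of a cache order -/

section Esymm

variable {α : Type*}

/-- The `k`-th elementary symmetric function of the values of `L` on a finite set `A`. -/
def esymmOn (L : α → ℕ) (A : Finset α) (k : ℕ) : ℕ :=
  ∑ q ∈ A.powersetCard k, ∏ c ∈ q, L c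

theorem esymmOn_succ_eq_zero (L : α → ℕ) {A : Finset α} {k : ℕ} (h : esymmOn L A k = 0) :
    esymmOn L A (k + 1) = 0 := by
  unfold esymmOn at *
  rw [sum_eq_zero_iff] at *
  intro q hq
  obtain ⟨h1, h2⟩ := mem_powersetCard.1 hq
  obtain ⟨p, hp, hpc⟩ := exists_subset_card_eq (s := q) (n := k) (by omega)
  have h0 := h p (mem_powersetCard.2 ⟨hp.trans h1, hpc⟩)
  obtain ⟨c, hc, hc0⟩ := prod_eq_zero_iff.1 h0
  exact prod_eq_zero (hp hc) hc0

variable [DecidableEq α]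

theorem esymmOn_eq_erase (L : α → ℕ) {A : Finset α} {c : α} (hc : c ∈ A) (k : ℕ) :
    esymmOn L A (k + 1) = L c * esymmOn L (A.erase c) k + esymmOn L (A.erase c) (k + 1) := by
  have hn : c ∉ A.erase c := notMem_erase c A
  conv_lhs => rw [← insert_erase hc]
  unfold esymmOn
  rw [powersetCard_succ_insert hn, sum_union, sum_image, mul_sum, add_comm]
  · congr 1
    refine sum_congr rfl fun q hq => ?_
    rw [prod_insert fun h => hn ((mem_powersetCard.1 hq).1 h)]
  · intro q hq q' hq' h
    have hq1 : c ∉ q := fun h => hn ((mem_powersetCard.1 hq).1 h)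
    have hq2 : c ∉ q' := fun h => hn ((mem_powersetCard.1 hq').1 h)
    rw [← erase_insert hq1, ← erase_insert hq2]
    exact congrArg (fun s => s.erase c) h
  · rw [disjoint_left]
    intro q hq hq'
    obtain ⟨q', -, rfl⟩ := mem_image.1 hq'
    exact hn ((mem_powersetCard.1 hq).1 (mem_insert_self c q'))

/-- Double counting: a `k`-subset `q` survives the erasure of exactly the `c ∈ A \ q`. For `k >
A.card` there are no such `q`. -/
theorem sum_esymmOn_erase (L : α → ℕ) (A : Finset α) (k : ℕ) :
    ∑ c ∈ A, esymmOn L (A.erase c) k = (A.card - k) * esymmOn L A k := by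
  unfold esymmOn
  rw [sum_comm' (t' := A.powersetCard k) (s' := fun q => A \ q), mul_sum]
  · refine sum_congr rfl fun q hq => ?_
    obtain ⟨h1, h2⟩ := mem_powersetCard.1 hq
    rw [sum_const, card_sdiff_of_subset h1, h2, smul_eq_mul]
  · intro c q
    simp only [mem_powersetCard, mem_sdiff, subset_erase]
    tauto

/-- The sum over the caches `c` of a list of `L c` times the number of those elements of `B` that
are stored neither in `c` nor in a cache before `c`. -/
def orderValue {β : Type*} (L : α → ℕ) (S : β → Finset α) : List α → Finset β → ℕ
  | [], _ => 0
  | c :: l, B => L c * (B.filter fun b => c ∉ S b).card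
      + orderValue L S l (B.filter fun b => c ∉ S b)

theorem sum_card_filter_notMem {β : Type*} (S : β → Finset α) (A : Finset α) (B : Finset β)
    (k : ℕ) (hB : ∀ b ∈ B, S b ⊆ A ∧ (S b).card = k) :
    ∑ c ∈ A, (B.filter fun b => c ∉ S b).card = (A.card - k) * B.card := by
  simp_rw [card_filter]
  rw [sum_comm, mul_comm, ← smul_eq_mul, ← sum_const]
  refine sum_congr rfl fun b hb => ?_
  rw [← card_filter, ← sdiff_eq_filter, card_sdiff_of_subset (hB b hb).1, (hB b hb).2]

/-- Some order of the caches is at least as good as the ratio of consecutive elementary symmetric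
functions. -/
theorem exists_order {β : Type*} (L : α → ℕ) (S : β → Finset α) (k : ℕ) (n : ℕ) :
    ∀ (A : Finset α) (B : Finset β), A.card = n → (∀ b ∈ B, S b ⊆ A ∧ (S b).card = k) →
      ∃ l : List α, l.Nodup ∧ (∀ c ∈ l, c ∈ A) ∧
        esymmOn L A (k + 1) * B.card ≤ esymmOn L A k * orderValue L S l B := by
  induction n with
  | zero =>
    intro A B hA _
    refine ⟨[], List.nodup_nil, by simp, ?_⟩
    rw [card_eq_zero.1 hA]
    rw [esymmOn, powersetCard_eq_empty.2 (by simp)]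
    simp
  | succ n ih =>
    intro A B hA hB
    by_cases h0 : esymmOn L A (k + 1) = 0
    -- The empty order suffices here; otherwise `h0` makes `hpos` below available for cancellation.
    · exact ⟨[], List.nodup_nil, by simp, by simp [h0]⟩
    have hne : A.Nonempty := card_pos.1 (by omega)
    obtain ⟨c, hc, hle⟩ : ∃ c ∈ A, B.card * esymmOn L (A.erase c) k ≤
        esymmOn L A k * (B.filter fun b => c ∉ S b).card := by
      -- Summed over `c ∈ A`, both sides equal `(A.card - k) * esymmOn L A k * B.card`.
      refine exists_le_of_sum_le hne (le_of_eq ?_)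
      rw [← mul_sum, ← mul_sum, sum_esymmOn_erase, sum_card_filter_notMem S A B k hB]
      ring
    obtain ⟨l, hl, hlA, hv⟩ := ih (A.erase c) (B.filter fun b => c ∉ S b)
      (by rw [card_erase_of_mem hc]; omega) (by
        intro b hb
        obtain ⟨hb1, hb2⟩ := mem_filter.1 hb
        exact ⟨subset_erase.2 ⟨(hB b hb1).1, hb2⟩, (hB b hb1).2⟩)
    have hrec := esymmOn_eq_erase L hc k
    have hpos : 0 < esymmOn L (A.erase c) k := by
      rw [Nat.pos_iff_ne_zero]
      intro hz
      rw [hz, esymmOn_succ_eq_zero L hz] at hrec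
      exact h0 (by simpa using hrec)
    refine ⟨c :: l, List.nodup_cons.2 ⟨fun h => notMem_erase c A (hlA c h), hl⟩, ?_, ?_⟩
    · intro c' hc'
      rcases List.mem_cons.1 hc' with rfl | h
      · exact hc
      · exact mem_of_mem_erase (hlA c' h)
    · refine Nat.le_of_mul_le_mul_left ?_ hpos
      rw [orderValue]
      generalize (B.filter fun b => c ∉ S b) = B' at *
      calc esymmOn L (A.erase c) k * (esymmOn L A (k + 1) * B.card)
          = esymmOn L A (k + 1) * (B.card * esymmOn L (A.erase c) k) := by ring
        _ ≤ esymmOn L A (k + 1) * (esymmOn L A k * B'.card) := Nat.mul_le_mul_left _ hle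
        _ = esymmOn L A k * (esymmOn L (A.erase c) k * (L c * B'.card)
              + esymmOn L (A.erase c) (k + 1) * B'.card) := by rw [hrec]; ring
        _ ≤ esymmOn L A k * (esymmOn L (A.erase c) k * (L c * B'.card)
              + esymmOn L (A.erase c) k * orderValue L S l B') := by gcongr
        _ = _ := by ring

end Esymm

/-! ### The converse for a fixed placement -/

variable {Λ N F : ℕ}

/-- The caches that store a given library bit. -/
def storedIn (Z : Placement Λ N F) (b : Fin N × Fin F) : Finset (Fin Λ) :=
  univ.filter fun c => b ∈ Z c

/-- The bits of `B` that are requested by a user of some cache `c` of the list and stored neither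
in `c` nor in a cache before `c`. -/
def freshBits (L : Fin Λ → ℕ) (Z : Placement Λ N F) (d : User L → Fin N) :
    List (Fin Λ) → Finset (Fin N × Fin F) → Finset (Fin N × Fin F)
  | [], _ => ∅
  | c :: l, B =>
    ((B.filter fun b => c ∉ storedIn Z b).filter fun b => ∃ i : Fin (L c), d ⟨c, i⟩ = b.1)
      ∪ freshBits L Z d l (B.filter fun b => c ∉ storedIn Z b)

/-- The number of fresh bits, counted user by user. -/
def freshCount (L : Fin Λ → ℕ) (Z : Placement Λ N F) (d : User L → Fin N) :
    List (Fin Λ) → Finset (Fin N × Fin F) → ℕ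
  | [], _ => 0
  | c :: l, B =>
    ∑ i : Fin (L c), ((B.filter fun b => c ∉ storedIn Z b).filter fun b => d ⟨c, i⟩ = b.1).card
      + freshCount L Z d l (B.filter fun b => c ∉ storedIn Z b)

theorem freshBits_subset (L : Fin Λ → ℕ) (Z : Placement Λ N F) (d : User L → Fin N)
    (l : List (Fin Λ)) : ∀ B, freshBits L Z d l B ⊆ B := by
  induction l with
  | nil => exact fun B => empty_subset B
  | cons c l ih =>
    exact fun B => union_subset ((filter_subset _ _).trans (filter_subset _ _))
      ((ih _).trans (filter_subset _ _))

theorem exists_user_of_mem_freshBits (L : Fin Λ → ℕ) (Z : Placement Λ N F) (d : User L → Fin N)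
    (l : List (Fin Λ)) :
    ∀ B, ∀ b ∈ freshBits L Z d l B, ∃ u : User L, u.1 ∈ l ∧ d u = b.1 := by
  induction l with
  | nil => intro B b hb; simp [freshBits] at hb
  | cons c l ih =>
    intro B b hb
    rcases mem_union.1 hb with h | h
    · obtain ⟨i, hi⟩ := (mem_filter.1 h).2
      exact ⟨⟨c, i⟩, by simp, hi⟩
    · obtain ⟨u, hu, hd⟩ := ih _ b h
      exact ⟨u, List.mem_cons_of_mem _ hu, hd⟩

/-- Distinct users request distinct files, so no bit is counted twice, within a cache or across
caches. -/
theorem freshCount_le_card (L : Fin Λ → ℕ) (Z : Placement Λ N F) {d : User L → Fin N}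
    (hd : Function.Injective d) (l : List (Fin Λ)) (hl : l.Nodup) :
    ∀ B, freshCount L Z d l B ≤ (freshBits L Z d l B).card := by
  induction l with
  | nil => intro B; simp [freshCount]
  | cons c l ih =>
    intro B
    obtain ⟨hc, hl⟩ := List.nodup_cons.1 hl
    rw [freshCount, freshBits, card_union_of_disjoint]
    · refine Nat.add_le_add (le_of_eq ?_) (ih hl _)
      rw [← card_biUnion]
      · congr 1
        ext b
        simp
      · intro i _ j _ hij
        rw [Function.onFun, disjoint_left]
        intro b hb hb'
        have h := hd ((mem_filter.1 hb).2.trans (mem_filter.1 hb').2.symm)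
        simp only [Sigma.mk.injEq, heq_eq_eq, true_and] at h
        exact hij h
    · rw [disjoint_left]
      intro b hb hb'
      obtain ⟨i, hi⟩ := (mem_filter.1 hb).2
      obtain ⟨u, hu, hdu⟩ := exists_user_of_mem_freshBits L Z d l _ b hb'
      have h := hd (hi.trans hdu.symm)
      rw [← h] at hu
      exact hc hu

/-- A message and the library bits that are not fresh determine the whole library. -/
theorem eq_of_enc_eq {L : Fin Λ → ℕ} {Z : Placement Λ N F} {d : User L → Fin N} {M : ℕ}
    (D : DeliveryScheme L Z d M) {W W' : Library N F} (henc : D.enc W = D.enc W')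
    (l : List (Fin Λ)) :
    ∀ B, (∀ b ∉ freshBits L Z d l B, W b.1 b.2 = W' b.1 b.2) → W = W' := by
  induction l with
  | nil =>
    intro B h
    funext n i
    exact h (n, i) (by simp [freshBits])
  | cons c l ih =>
    intro B h
    have hcache : cacheContent Z c W = cacheContent Z c W' := by
      funext b
      -- Fresh bits are never stored in the first cache of the list.
      refine h b.1 fun hb => ?_
      have hb' : b.1 ∈ B.filter fun b => c ∉ storedIn Z b := by
        rcases mem_union.1 hb with h1 | h1
        · exact (mem_filter.1 h1).1
        · exact freshBits_subset L Z d l _ h1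
      exact (mem_filter.1 hb').2 (by simp [storedIn])
    have hdec (i : Fin (L c)) : W (d ⟨c, i⟩) = W' (d ⟨c, i⟩) := by
      rw [← D.correct W ⟨c, i⟩, ← D.correct W' ⟨c, i⟩, henc, hcache]
    refine ih (B.filter fun b => c ∉ storedIn Z b) fun b hb => ?_
    by_cases hex : ∃ i : Fin (L c), d ⟨c, i⟩ = b.1
    · obtain ⟨i, hi⟩ := hex
      rw [← hi, hdec i]
    · refine h b fun hb' => ?_
      rcases mem_union.1 hb' with h1 | h1
      · exact hex (mem_filter.1 h1).2
      · exact hb h1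

/-- With all other bits set to `false`, the encoder is injective in the fresh bits. -/
theorem two_pow_card_freshBits_le {L : Fin Λ → ℕ} {Z : Placement Λ N F} {d : User L → Fin N}
    {M : ℕ} (D : DeliveryScheme L Z d M) (l : List (Fin Λ)) (B : Finset (Fin N × Fin F)) :
    2 ^ (freshBits L Z d l B).card ≤ M := by
  set T := freshBits L Z d l B with hT
  let ext : (T → Bool) → Library N F := fun x n i => if h : (n, i) ∈ T then x ⟨(n, i), h⟩ else false
  have hinj : Function.Injective fun x => D.enc (ext x) := by
    intro x y hxy
    have h : ext x = ext y := eq_of_enc_eq D hxy l B fun b hb => by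
      have hb' : (b.1, b.2) ∉ T := hb
      simp only [ext, dif_neg hb']
    funext b
    have hb := congrFun (congrFun h b.1.1) b.1.2
    have hmem : (b.1.1, b.1.2) ∈ T := b.2
    simpa only [ext, dif_pos hmem] using hb
  simpa using Fintype.card_le_of_injective _ hinj

/-- Under the shifts each user requests every file exactly once. -/
theorem sum_freshCount_shift [NeZero N] (L : Fin Λ → ℕ) (Z : Placement Λ N F)
    (d : User L → Fin N) (l : List (Fin Λ)) :
    ∀ B, ∑ s : Fin N, freshCount L Z (fun u => d u + s) l B
      = orderValue L (storedIn Z) l B := by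
  induction l with
  | nil => intro B; simp [freshCount, orderValue]
  | cons c l ih =>
    intro B
    simp only [freshCount, orderValue]
    rw [sum_add_distrib, ih, sum_comm]
    congr 1
    have h (i : Fin (L c)) : ∑ s : Fin N, ((B.filter fun b => c ∉ storedIn Z b).filter
        fun b => d ⟨c, i⟩ + s = b.1).card = (B.filter fun b => c ∉ storedIn Z b).card := by
      rw [card_eq_sum_card_fiberwise (f := fun b : Fin N × Fin F => b.1) (t := univ)
        (fun _ _ => by simp)]
      refine Fintype.sum_equiv (Equiv.addLeft (d ⟨c, i⟩)) _ _ fun s => ?_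
      exact congrArg card (filter_congr fun b _ => eq_comm)
    simp [h]

/-- The demand-averaged converse for placements that store every bit in `k` caches. -/
theorem exists_demand_bound [NeZero N] (L : Fin Λ → ℕ) (hN : ∑ c, L c ≤ N) (Z : Placement Λ N F)
    (k : ℕ) (hZ : ∀ b, (storedIn Z b).card = k) :
    ∃ d : User L → Fin N, ∀ M, DeliveryScheme L Z d M →
      ∃ m : ℕ, esymmOn L univ (k + 1) * F ≤ esymmOn L univ k * m ∧ 2 ^ m ≤ M := by
  obtain ⟨l, hl, -, hv⟩ := exists_order L (storedIn Z) k Λ univ univ (by simp)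
    (fun b _ => ⟨subset_univ _, hZ b⟩)
  obtain ⟨ι⟩ : Nonempty (User L ↪ Fin N) :=
    Function.Embedding.nonempty_of_card_le (by simpa using hN)
  obtain ⟨s, -, hs⟩ : ∃ s ∈ (univ : Finset (Fin N)), esymmOn L univ (k + 1) * F ≤
      esymmOn L univ k * freshCount L Z (fun u => ι u + s) l univ := by
    refine exists_le_of_sum_le univ_nonempty ?_
    rw [← mul_sum univ (fun s : Fin N => freshCount L Z (fun u => ι u + s) l univ),
      sum_freshCount_shift]
    refine le_trans (le_of_eq ?_) hv
    simp
    ring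
  refine ⟨fun u => ι u + s, fun M D => ⟨_, hs, ?_⟩⟩
  refine le_trans (Nat.pow_le_pow_right two_pos ?_) (two_pow_card_freshBits_le D l univ)
  exact freshCount_le_card L Z (fun u v h => ι.injective (add_right_cancel h)) l hl univ

/-! ### From the counting bound to delivery times -/

theorem redundancy_eq_of_regular (hN : 0 < N) (hF : 0 < F) (Z : Placement Λ N F) (r : ℕ)
    (hZ : ∀ b, (storedIn Z b).card = r) : redundancy Z = r := by
  have h : ∑ c, (Z c).card = N * F * r := by
    have h1 : ∑ b, (storedIn Z b).card = ∑ c, (Z c).card := by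
      simp_rw [storedIn, card_filter]
      rw [sum_comm]
      simp
    rw [← h1]
    simp [hZ]
  have hN' : (N : ℝ) ≠ 0 := by positivity
  have hF' : (F : ℝ) ≠ 0 := by positivity
  unfold redundancy normSize
  rw [← sum_div, ← Nat.cast_sum, h]
  push_cast
  field_simp

theorem elemSymm_eq_esymmOn (L : Fin Λ → ℕ) (k : ℕ) : elemSymm L k = esymmOn L univ k :=
  esymm_map_val L univ k

theorem elemSymm_ratio_le_optimal (N : ℕ) (L : Fin Λ → ℕ) (hN : ∑ c, L c ≤ N) (t : ℕ)
    (ht : elemSymm L t ≠ 0) :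
    (((elemSymm L (t + 1) : ℝ) / (elemSymm L t : ℝ) : ℝ) : EReal)
      ≤ optimalRegularDeliveryTime N L (t : ℝ) := by
  refine le_iInf fun F => le_iInf fun hF => le_iInf fun Z => le_iInf fun hreg => le_iInf fun hred =>
    ?_
  rw [elemSymm_eq_esymmOn, elemSymm_eq_esymmOn]
  rw [elemSymm_eq_esymmOn] at ht
  suffices H : ∃ d : User L → Fin N, ∀ M, DeliveryScheme L Z d M →
      ∃ m : ℕ, esymmOn L univ (t + 1) * F ≤ esymmOn L univ t * m ∧ 2 ^ m ≤ M by
    obtain ⟨d, hd⟩ := H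
    refine le_iSup_of_le d (le_iInf fun M => le_iInf fun ⟨D⟩ => EReal.coe_le_coe_iff.2 ?_)
    obtain ⟨m, hm, hM⟩ := hd M D
    have hlog : (m : ℝ) ≤ Real.logb 2 M := by
      have hM' : (2 : ℝ) ^ (m : ℝ) ≤ M := by
        rw [Real.rpow_natCast]
        exact_mod_cast hM
      have hMpos : (0 : ℝ) < M := lt_of_lt_of_le (by positivity) hM'
      exact (Real.le_logb_iff_rpow_le one_lt_two hMpos).2 hM'
    have hE : (0 : ℝ) < esymmOn L univ t := by exact_mod_cast Nat.pos_of_ne_zero ht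
    rw [div_le_div_iff₀ hE (by exact_mod_cast hF)]
    calc (esymmOn L univ (t + 1) : ℝ) * F ≤ esymmOn L univ t * m := by exact_mod_cast hm
      _ ≤ esymmOn L univ t * Real.logb 2 M := by gcongr
      _ = _ := mul_comm _ _
  -- For `N = 0` regularity is vacuous and does not tie `r` to `t`; but then all `L c = 0`, so the
  -- bound is `0`, and `M ≥ 1` suffices.
  rcases Nat.eq_zero_or_pos N with rfl | hpos
  · have hL : ∀ c, L c = 0 := by simpa using hN
    have hE : esymmOn L univ (t + 1) = 0 := by
      refine sum_eq_zero fun q hq => ?_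
      obtain ⟨c, hc⟩ := card_pos.1 (by rw [(mem_powersetCard.1 hq).2]; omega : 0 < q.card)
      exact prod_eq_zero hc (hL c)
    refine ⟨fun u => ((finCongr (hL u.1)) u.2), fun M D => ⟨0, by simp [hE], ?_⟩⟩
    exact Nat.succ_le_of_lt ((Nat.zero_le _).trans_lt (D.enc fun _ _ => false).isLt)
  · have : NeZero N := ⟨hpos.ne'⟩
    obtain ⟨r, hr⟩ := hreg
    have hrt : r = t := by
      have h := redundancy_eq_of_regular hpos hF Z r hr
      rw [hred] at h
      exact_mod_cast h.symm
    exact exists_demand_bound L hN Z t fun b => (hr b).trans hrt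

end SharedCache

theorem theorem2 {Λ : ℕ} (N : ℕ) (L : Fin Λ → ℕ) (hN : ∑ c, L c ≤ N)
    (t : ℕ) (ht : SharedCache.elemSymm L t ≠ 0) :
    (((SharedCache.elemSymm L (t + 1) : ℝ) / (SharedCache.elemSymm L t : ℝ) : ℝ) : EReal)
        ≤ SharedCache.optimalRegularDeliveryTime N L (t : ℝ) ∧
    (SharedCache.elemSymm L (t + 1) : ℝ) / (SharedCache.elemSymm L t : ℝ)
        = (∑ q ∈ (Finset.univ : Finset (Fin Λ)).powersetCard (t + 1), ∏ c ∈ q, (L c : ℝ)) /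
          (∑ q ∈ (Finset.univ : Finset (Fin Λ)).powersetCard t, ∏ c ∈ q, (L c : ℝ)) ∧
    ((∀ c, L c = 1) →
      (SharedCache.elemSymm L (t + 1) : ℝ) / (SharedCache.elemSymm L t : ℝ)
          = ((Λ.choose (t + 1) : ℝ) - ((Λ - min Λ N).choose (t + 1) : ℝ)) / (Λ.choose t : ℝ) ∧
      (SharedCache.elemSymm L (t + 1) : ℝ) / (SharedCache.elemSymm L t : ℝ)
          = ((Λ : ℝ) - (t : ℝ)) / ((t : ℝ) + 1)) := by
  refine ⟨SharedCache.elemSymm_ratio_le_optimal N L hN t ht, ?_, fun hL => ?_⟩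
  · simp only [SharedCache.elemSymm_eq_esymmOn, SharedCache.esymmOn]
    push_cast
    rfl
  · have hE (k : ℕ) : SharedCache.elemSymm L k = Λ.choose k := by
      rw [SharedCache.elemSymm_eq_esymmOn]
      simp [SharedCache.esymmOn, hL]
    have hΛ : Λ ≤ N := by simpa [hL] using hN
    rw [hE] at ht
    have htΛ : t ≤ Λ := by
      by_contra h
      exact ht (Nat.choose_eq_zero_of_lt (by omega))
    rw [hE, hE, min_eq_left hΛ]
    refine ⟨by simp, ?_⟩
    have hc : (Λ.choose t : ℝ) ≠ 0 := by exact_mod_cast ht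
    have hs : ((t : ℝ) + 1) ≠ 0 := by positivity
    rw [div_eq_div_iff hc hs, ← Nat.cast_sub htΛ]
    have h := Nat.choose_succ_right_eq Λ t
    rw [mul_comm (Λ.choose t)] at h
    exact_mod_cast h
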